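/- **Theorem 6.1 (Non-existence).** Let $n\ge 3$ and let $\Omega\subset\mathbb R^n$ be a bounded domain (a nonempty connected open set) with smooth boundary. At $p\in\partial\Omega$ let $\nu$ be the outward unit normal, let $II(X,Y)=\langle D_X\nu,Y\rangle$ for $X,Y\in T_p\partial\Omega$ be the second fundamental form (so $II\ge 0$ if $\Omega$ is convex), and let the mean curvature $H(p)$ be the trace of $II$ on $T_p\partial\Omega$. Suppose that $\Omega$ is mean convex, i.e. $H\ge 0$ on $\partial\Omega$, and that there is a point $q\in\partial\Omega$ with $H(q)=0$ at which $\partial\Omega$ is not convex, i.e. $II(X,X)<0$ for some $X\in T_q\partial\Omega$. Then for every $0<\varepsilon\le 1$ there is $\psi=(\psi^1,\psi^2)\in C^2(\overline\Omega,\mathbb R^2)$ (in fact $\psi$ may be taken to be the restriction of a $C^2$ map $\mathbb R^n\to\mathbb R^2$) with $|D\psi^1|\le\varepsilon$ on $\overline\Omega$ such that the Dirichlet problem for the minimal surface system $$\sum_{i,j=1}^n g^{ij}\,\frac{\partial^2u^\alpha}{\partial x_i\partial x_j}=0\ \text{ in }\Omega,\qquad u^\alpha=\psi^\alpha\ \text{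 on }\partial\Omega,\qquad \alpha=1,2,$$ where $(g^{ij})$ is the inverse of the matrix $g_{ij}=\delta_{ij}+\sum_{\alpha=1}^2\frac{\partial u^\alpha}{\partial x_i}\frac{\partial u^\alpha}{\partial x_j}$, has no classical solution $u=(u^1,u^2)\in C^2(\Omega,\mathbb R^2)\cap C^0(\overline\Omega,\mathbb R^2)$. -/

import Mathlib

open scoped ContDiff Topology

noncomputable section

namespace MinimalGraph

/-- Euclidean space `ℝⁿ` with its Euclidean norm and inner product. -/
abbrev Euc (n : ℕ) : Type := EuclideanSpace ℝ (Fin n)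

/-! ### Smooth domains and the curvature of their boundary -/

/-- `f` is a smooth local defining function of `Ω` at the boundary point `p`: near `p` the set `Ω`
is `{f < 0}`, and `f` vanishes at `p` with nonzero differential. In particular `f` increases in the
direction of the outward normal. -/
structure IsDefiningFunctionAt {n : ℕ} (Ω : Set (Euc n)) (p : Euc n) (f : Euc n → ℝ) : Prop where
  smooth : ContDiff ℝ ∞ f
  map_eq_zero : f p = 0
  fderiv_ne_zero : fderiv ℝ f p ≠ 0
  mem_iff : ∀ᶠ x in 𝓝 p, x ∈ Ω ↔ f x < 0

/-- A bounded domain (nonempty connected open set) of `ℝⁿ` with smooth boundary; the domain lies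
locally on one side of its boundary. -/
structure IsBoundedSmoothDomain {n : ℕ} (Ω : Set (Euc n)) : Prop where
  isOpen : IsOpen Ω
  isConnected : IsConnected Ω
  isBounded : Bornology.IsBounded Ω
  smooth_boundary : ∀ p ∈ frontier Ω, ∃ f : Euc n → ℝ, IsDefiningFunctionAt Ω p f

/-- The tangent hyperplane at `p` of the level set of `f` through `p`. -/
def tangentHyperplane {n : ℕ} (f : Euc n → ℝ) (p : Euc n) : Submodule ℝ (Euc n) :=
  LinearMap.ker (fderiv ℝ f p : Euc n →ₗ[ℝ] ℝ)

/-- The second fundamental form at `p` of the level set of `f` through `p`, in the sign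
convention `II(X, Y) = ⟨D_X ν, Y⟩` with `ν = ∇f / |∇f|` the outward unit normal of `{f < 0}`.
For tangential `X`, `Y` this equals `D²f(X, Y) / |∇f|`. With this sign the boundary of a convex
domain has `II ≥ 0`, and for a curve in the level set through `p` with velocity `X` the component
of the acceleration along the inward normal is `II(X, X)`. -/
def secondFundamentalForm {n : ℕ} (f : Euc n → ℝ) (p : Euc n) (X Y : tangentHyperplane f p) : ℝ :=
  fderiv ℝ (fderiv ℝ f) p (X : Euc n) (Y : Euc n) / ‖fderiv ℝ f p‖

/-- The mean curvature (sum of the principal curvatures) at `p` of the level set of `f` through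
`p`: the trace of the second fundamental form over the tangent hyperplane. It is positive for the
boundary of a ball. -/
def meanCurvature {n : ℕ} (f : Euc n → ℝ) (p : Euc n) : ℝ :=
  ∑ i, secondFundamentalForm f p
    (stdOrthonormalBasis ℝ (tangentHyperplane f p) i)
    (stdOrthonormalBasis ℝ (tangentHyperplane f p) i)

/-- The boundary of `Ω` has nonnegative mean curvature with respect to the inward normal. -/
def IsMeanConvex {n : ℕ} (Ω : Set (Euc n)) : Prop :=
  ∀ p ∈ frontier Ω, ∀ f : Euc n → ℝ, IsDefiningFunctionAt Ω p f → 0 ≤ meanCurvature f p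

/-- At `q`, the boundary of `Ω` has zero mean curvature but is not convex: its second
fundamental form takes a negative value on some tangent vector (equivalently, some principal
curvature is negative). -/
def IsNonconvexMinimalPoint {n : ℕ} (Ω : Set (Euc n)) (q : Euc n) : Prop :=
  ∃ f : Euc n → ℝ, IsDefiningFunctionAt Ω q f ∧ meanCurvature f q = 0 ∧
    ∃ X : tangentHyperplane f q, secondFundamentalForm f q X X < 0

/-! ### The minimal surface system -/

/-- The partial derivative `∂f/∂xᵢ` at `x`. -/
def partialDeriv {n : ℕ} (i : Fin n) (f : Euc n → ℝ) (x : Euc n) : ℝ :=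
  fderiv ℝ f x (EuclideanSpace.single i 1)

/-- The metric `g_ij = δ_ij + ∑_α ∂ᵢu^α ∂ⱼu^α` of the graph of `u`. It is positive definite, so
that its matrix inverse is the true inverse `g^ij`. -/
def graphMetric {n m : ℕ} (u : Euc n → Euc m) (x : Euc n) : Matrix (Fin n) (Fin n) ℝ :=
  Matrix.of fun i j => (if i = j then 1 else 0) +
    ∑ α : Fin m, partialDeriv i (fun y => u y α) x * partialDeriv j (fun y => u y α) x

/-- `u` is a classical solution, twice continuously differentiable in `Ω` and continuous up to
the boundary, of the Dirichlet problem for the minimal surface system: `∑_{i,j} g^ij ∂ᵢ∂ⱼu^α = 0`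
in `Ω` for every `α`, and `u = ψ` on the boundary of `Ω`. -/
structure IsClassicalSolution {n m : ℕ} (Ω : Set (Euc n)) (ψ u : Euc n → Euc m) : Prop where
  contDiffOn : ContDiffOn ℝ 2 u Ω
  continuousOn : ContinuousOn u (closure Ω)
  system : ∀ x ∈ Ω, ∀ α : Fin m,
    ∑ i, ∑ j, (graphMetric u x)⁻¹ i j *
      partialDeriv i (partialDeriv j (fun y => u y α)) x = 0
  boundary : ∀ x ∈ frontier Ω, u x = ψ x

end MinimalGraph

end

noncomputable section

namespace MinimalGraph

variable {n : ℕ}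

/-! ### Second order conditions at a local maximum -/

/-! A linear first component tilts the base metric until the boundary at `q` has negative mean
curvature, and then the classical obstruction for the scalar minimal surface equation applies.

Since `II` at `q` has trace zero and a negative value, some unit tangent vector `e` has `II(e, e) >
0` (`exists_tangent_hessian_pos`). Prescribe `ψ¹ = ε⟨e, x⟩`. With its coefficients frozen, the
equation for `u¹` is linear elliptic without lower order terms, so the maximum principle gives `u¹ =
ε⟨e, x⟩` (`IsClassicalSolution.component_eq_linear`). Hence `v = u²` solves the minimal hypersurface
equation over `Ω` with the flat metric `1 + ε² e ⊗ e`. In that metric the mean curvature of the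
boundary at `q` is a positive multiple of `-κ II(e, e) < 0`, where `κ = ε² / (1 + ε²)`
(`levelCurvature_eq`).

At such a point `v(q)` is bounded by a constant depending only on an upper bound for `v` on the
boundary away from `q` (`exists_boundary_bound`). The barriers are `C - 2k√(F - δ)`, with infinite
slope on `{F = δ}`, so that no boundary values are needed there (`le_barrier`). One with `F` the
squared distance to `q` bounds `v` away from `q`; one with `F = -f` carries the bound up to `q`.
Taking `ψ²` to be a bump at `q` exceeding this bound excludes every solution. -/

theorem deriv_eq_zero_and_nonpos_of_isLocalMax {φ φ' : ℝ → ℝ} {c : ℝ}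
    (h : ∀ᶠ t in 𝓝 (0 : ℝ), HasDerivAt φ (φ' t) t) (h' : HasDerivAt φ' c 0)
    (hmax : IsLocalMax φ 0) : φ' 0 = 0 ∧ c ≤ 0 := by
  have h0 : φ' 0 = 0 := hmax.hasDerivAt_eq_zero h.self_of_nhds
  refine ⟨h0, ?_⟩
  by_contra! hc
  have hd : deriv φ =ᶠ[𝓝 0] φ' := h.mono fun t ht => ht.deriv
  have hdd : deriv (deriv φ) 0 = c := by rw [hd.deriv_eq, h'.deriv]
  -- If `c > 0`, the point is also a local minimum, so `φ` is locally constant and its second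
  -- derivative is zero.
  have hmin : IsLocalMin φ 0 :=
    isLocalMin_of_deriv_deriv_pos (by rw [hdd]; exact hc) (by rw [hd.self_of_nhds, h0])
      h.self_of_nhds.continuousAt
  have hconst : φ =ᶠ[𝓝 0] fun _ => φ 0 := by
    filter_upwards [hmax, hmin] with t h1 h2 using le_antisymm h1 h2
  have h2 : deriv φ =ᶠ[𝓝 0] fun _ => 0 := by
    have := hconst.deriv
    simpa using this
  have : deriv (deriv φ) 0 = 0 := by rw [h2.deriv_eq]; simp
  linarith

section Lines

variable {E : Type*} [NormedAddCommGroup E] [NormedSpace ℝ E] {v : E → ℝ} {x : E}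

theorem tendsto_line (x X : E) : Filter.Tendsto (fun t : ℝ => x + t • X) (𝓝 0) (𝓝 x) := by
  have : Continuous fun t : ℝ => x + t • X := by fun_prop
  simpa using this.tendsto 0

theorem hasDerivAt_line (x X : E) (t : ℝ) : HasDerivAt (fun t : ℝ => x + t • X) X t := by
  simpa using ((hasDerivAt_id t).smul_const X).const_add x

theorem eventually_hasDerivAt_comp_line (hv : ContDiffAt ℝ 2 v x) (X : E) :
    ∀ᶠ t in 𝓝 (0 : ℝ),
      HasDerivAt (fun t : ℝ => v (x + t • X)) (fderiv ℝ v (x + t • X) X) t := by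
  have h1 : ∀ᶠ y in 𝓝 x, ContDiffAt ℝ 2 v y := hv.eventually (by simp)
  filter_upwards [(tendsto_line x X).eventually h1] with t ht
  exact (ht.differentiableAt (by norm_num)).hasFDerivAt.comp_hasDerivAt t (hasDerivAt_line x X t)

theorem differentiableAt_fderiv (hv : ContDiffAt ℝ 2 v x) : DifferentiableAt ℝ (fderiv ℝ v) x :=
  (hv.fderiv_right (m := 1) (by norm_num)).differentiableAt (by norm_num)

theorem hasDerivAt_fderiv_comp_line (hv : ContDiffAt ℝ 2 v x) (X : E) :
    HasDerivAt (fun t : ℝ => fderiv ℝ v (x + t • X) X) (fderiv ℝ (fderiv ℝ v) x X X) 0 := by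
  have h1 : HasFDerivAt (fderiv ℝ v) (fderiv ℝ (fderiv ℝ v) x) (x + (0 : ℝ) • X) := by
    simpa using (differentiableAt_fderiv hv).hasFDerivAt
  have h2 : HasDerivAt (fun t : ℝ => fderiv ℝ v (x + t • X)) (fderiv ℝ (fderiv ℝ v) x X) 0 :=
    h1.comp_hasDerivAt (0 : ℝ) (hasDerivAt_line x X 0)
  simpa using h2.clm_apply (hasDerivAt_const (0 : ℝ) X)

theorem isLocalMax_comp_line {g : E → ℝ} (hg : IsLocalMax g x) (X : E) :
    IsLocalMax (fun t : ℝ => g (x + t • X)) 0 := by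
  have := (tendsto_line x X).eventually hg
  simpa [IsLocalMax, IsMaxFilter] using this

end Lines

/-- A function with a downward vertical tangent in the direction of increasing `s` cannot touch a
differentiable function from above. -/
theorem not_eventually_add_sqrt_le {φ s : ℝ → ℝ} {d c k : ℝ} (hk : 0 < k)
    (hφ : HasDerivAt φ d 0) (hs : HasDerivAt s c 0) (hs0 : s 0 = 0) (hc : 0 < c) :
    ¬ ∀ᶠ t in 𝓝[>] (0 : ℝ), φ t + 2 * k * √(s t) ≤ φ 0 := by
  intro h
  have hφ' := hφ.tendsto_slope_zero_right
  have hs' := hs.tendsto_slope_zero_right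
  simp only [zero_add, smul_eq_mul, hs0, sub_zero] at hφ' hs'
  have hid : Filter.Tendsto (fun t : ℝ => t) (𝓝[>] 0) (𝓝 0) := nhdsWithin_le_nhds
  -- Squaring the inequality and dividing by `t` compares these two limits: `4k²c ≤ 0`.
  have h1 : Filter.Tendsto (fun t : ℝ => t * (t⁻¹ * (φ t - φ 0)) ^ 2) (𝓝[>] 0) (𝓝 (0 * d ^ 2)) :=
    hid.mul (hφ'.pow 2)
  have h2 : Filter.Tendsto (fun t : ℝ => 4 * k ^ 2 * (t⁻¹ * s t)) (𝓝[>] 0)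
      (𝓝 (4 * k ^ 2 * c)) := hs'.const_mul _
  have h3 : 4 * k ^ 2 * c ≤ 0 * d ^ 2 := by
    refine le_of_tendsto_of_tendsto h2 h1 ?_
    filter_upwards [h, self_mem_nhdsWithin] with t ht ht0
    have ht0 : 0 < t := ht0
    have h4 : 0 ≤ 2 * k * √(s t) := by positivity
    have h5 : s t ≤ √(s t) ^ 2 := by
      rcases le_total 0 (s t) with hs | hs
      · rw [Real.sq_sqrt hs]
      · exact hs.trans (sq_nonneg _)
    have h6 : (2 * k * √(s t)) ^ 2 ≤ (φ 0 - φ t) ^ 2 := pow_le_pow_left₀ h4 (by linarith) 2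
    have h7 : 4 * k ^ 2 * s t ≤ (φ t - φ 0) ^ 2 := by
      have : 4 * k ^ 2 * s t ≤ 4 * k ^ 2 * √(s t) ^ 2 := by gcongr
      nlinarith
    calc 4 * k ^ 2 * (t⁻¹ * s t) = t⁻¹ * (4 * k ^ 2 * s t) := by ring
      _ ≤ t⁻¹ * (φ t - φ 0) ^ 2 := by gcongr
      _ = t * (t⁻¹ * (φ t - φ 0)) ^ 2 := by field_simp
  have : 0 < 4 * k ^ 2 * c := by positivity
  linarith

/-! ### Contractions with positive semidefinite matrices -/

theorem sum_smul_single (x : Euc n) : ∑ i, x i • EuclideanSpace.single i (1 : ℝ) = x := by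
  ext j
  simp [Finset.sum_apply, Pi.single_apply]

theorem bilin_apply_eq_sum (Q : Euc n →L[ℝ] Euc n →L[ℝ] ℝ) (x y : Euc n) :
    Q x y = ∑ i, ∑ j, x i * y j * Q (EuclideanSpace.single i 1) (EuclideanSpace.single j 1) := by
  conv_lhs => rw [← sum_smul_single x, ← sum_smul_single y]
  simp only [map_sum, map_smul, sum_apply, smul_apply,
    smul_eq_mul, Finset.mul_sum]
  rw [Finset.sum_comm]
  exact Finset.sum_congr rfl fun i _ => Finset.sum_congr rfl fun j _ => by ring

/-- A positive semidefinite matrix is a sum of squares `S ⊗ S`, and contracting `Q` with each gives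
`Q S S`. -/
theorem sum_mul_nonpos {P : Matrix (Fin n) (Fin n) ℝ} (hP : P.PosSemidef)
    (Q : Euc n →L[ℝ] Euc n →L[ℝ] ℝ) (hQ : ∀ X, Q X X ≤ 0) :
    ∑ i, ∑ j, P i j * Q (EuclideanSpace.single i 1) (EuclideanSpace.single j 1) ≤ 0 := by
  obtain ⟨m, S, rfl⟩ := Matrix.posSemidef_iff_eq_sum_vecMulVec.1 hP
  have : ∑ i, ∑ j, (∑ k, Matrix.vecMulVec (S k) (star (S k))) i j *
      Q (EuclideanSpace.single i 1) (EuclideanSpace.single j 1) =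
      ∑ k, Q (WithLp.toLp 2 (S k)) (WithLp.toLp 2 (S k)) := by
    simp only [bilin_apply_eq_sum Q (WithLp.toLp 2 (S _)), Matrix.sum_apply,
      Matrix.vecMulVec_apply, star_trivial, Finset.sum_mul]
    rw [Finset.sum_comm (s := Finset.univ (α := Fin m))]
    exact Finset.sum_congr rfl fun i _ => Finset.sum_comm
  rw [this]
  exact Finset.sum_nonpos fun k _ => hQ _

/-- Trace of a quadratic form along a tight frame. -/
theorem sum_single_eq (Q : Euc n →L[ℝ] Euc n →L[ℝ] ℝ) {ι : Type*} [Fintype ι] (c : ι → Euc n)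
    (hc : ∀ x, x = ∑ i, inner ℝ (c i) x • c i) :
    ∑ j, Q (EuclideanSpace.single j 1) (EuclideanSpace.single j 1) = ∑ i, Q (c i) (c i) := by
  have h1 : ∀ j, Q (EuclideanSpace.single j 1) (EuclideanSpace.single j 1) =
      ∑ i, c i j * Q (c i) (EuclideanSpace.single j 1) := by
    intro j
    conv_lhs =>
      arg 1
      rw [hc (EuclideanSpace.single j 1)]
    simp [EuclideanSpace.inner_single_right]
  simp_rw [h1]
  rw [Finset.sum_comm]
  refine Finset.sum_congr rfl fun i _ => ?_
  conv_rhs =>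
    arg 2
    rw [← sum_smul_single (c i)]
  simp

/-! ### The inverse of the metric -/

/-- Raising the index of a covector with respect to the metric `1 + ε² e ⊗ e`, where `e` is a unit
vector and `κ = ε² / (1 + ε²)`. -/
def raise (κ : ℝ) (e p : Euc n) : Euc n := p - (κ * inner ℝ e p) • e

theorem inner_raise (κ : ℝ) (e p : Euc n) :
    inner ℝ p (raise κ e p) = ‖p‖ ^ 2 - κ * inner ℝ e p ^ 2 := by
  rw [raise, inner_sub_right, inner_smul_right, real_inner_self_eq_norm_sq, real_inner_comm e p]
  ring

theorem inner_raise_nonneg {κ : ℝ} (hκ1 : κ ≤ 1) {e : Euc n} (he : ‖e‖ = 1)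
    (p : Euc n) : 0 ≤ inner ℝ p (raise κ e p) := by
  rw [inner_raise]
  have h := abs_real_inner_le_norm e p
  rw [he, one_mul] at h
  have h2 : inner ℝ e p ^ 2 ≤ ‖p‖ ^ 2 := by
    rw [← sq_abs]; exact pow_le_pow_left₀ (abs_nonneg _) h 2
  nlinarith [sq_nonneg (inner ℝ e p)]

/-- The metric of a graph in codimension two whose height functions have gradients `ε e`
and `p`. -/
def metricOf (ε : ℝ) (e p : Euc n) : Matrix (Fin n) (Fin n) ℝ :=
  1 + ε ^ 2 • Matrix.vecMulVec e e + Matrix.vecMulVec p p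

/-- Two rank-one (Sherman–Morrison) updates: `1 + ε² e ⊗ e` has inverse `1 - κ e ⊗ e`, and adding `p
⊗ p` subtracts a multiple of the square of the raised covector. -/
theorem metricOf_inv {ε : ℝ} {e : Euc n} (he : ‖e‖ = 1) (p : Euc n) :
    (metricOf ε e p)⁻¹ = 1 - (ε ^ 2 / (1 + ε ^ 2)) • Matrix.vecMulVec e e -
      (1 + inner ℝ p (raise (ε ^ 2 / (1 + ε ^ 2)) e p))⁻¹ •
        Matrix.vecMulVec (raise (ε ^ 2 / (1 + ε ^ 2)) e p) (raise (ε ^ 2 / (1 + ε ^ 2)) e p) := by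
  have h1 : (1 + ε ^ 2) ≠ 0 := by positivity
  set κ := ε ^ 2 / (1 + ε ^ 2) with hκ
  have hκ1 : κ ≤ 1 := by rw [hκ, div_le_one (by positivity)]; linarith
  have hN := inner_raise_nonneg hκ1 he p
  have hN' := inner_raise κ e p
  set N := inner ℝ p (raise κ e p)
  have hee : e.ofLp ⬝ᵥ e.ofLp = 1 := by
    have : inner ℝ e e = (1 : ℝ) := by rw [real_inner_self_eq_norm_sq, he]; norm_num
    rwa [EuclideanSpace.inner_eq_star_dotProduct, star_trivial] at this
  have hep : e.ofLp ⬝ᵥ p.ofLp = inner ℝ e p := by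
    simp [EuclideanSpace.inner_eq_star_dotProduct, dotProduct_comm]
  have hpe : p.ofLp ⬝ᵥ e.ofLp = inner ℝ e p := by
    rw [dotProduct_comm, hep]
  have hpp : p.ofLp ⬝ᵥ p.ofLp = ‖p‖ ^ 2 := by
    rw [← real_inner_self_eq_norm_sq, EuclideanSpace.inner_eq_star_dotProduct, star_trivial]
  set a := inner ℝ e p
  have hb : (raise κ e p).ofLp = p.ofLp - (κ * a) • e.ofLp := rfl
  have hNN : 1 + N ≠ 0 := by positivity
  apply Matrix.inv_eq_right_inv
  rw [metricOf, hb]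
  simp only [add_mul, mul_sub, mul_one, one_mul, Matrix.smul_mul, Matrix.mul_smul,
    Matrix.vecMulVec_mul_vecMulVec, dotProduct_sub, dotProduct_smul, hee, hep, hpe, hpp]
  ext i j
  simp only [Matrix.add_apply, Matrix.sub_apply, Matrix.smul_apply, Matrix.vecMulVec_apply,
    smul_eq_mul, Pi.sub_apply, Pi.smul_apply]
  have hp : ‖p‖ ^ 2 = N + κ * a ^ 2 := by linarith
  rw [hp]
  rw [hκ]
  field_simp
  ring

theorem metricOf_posDef (ε : ℝ) (e p : Euc n) : (metricOf ε e p).PosDef := by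
  have h : ∀ q : Euc n, (Matrix.vecMulVec q.ofLp q.ofLp).PosSemidef := fun q => by
    simpa using Matrix.posSemidef_vecMulVec_self_star q.ofLp
  exact (Matrix.PosDef.one.add_posSemidef ((h e).smul (sq_nonneg ε))).add_posSemidef (h p)

theorem sum_metricOf_inv_mul {ε : ℝ} {e : Euc n} (he : ‖e‖ = 1) (p : Euc n)
    (Q : Euc n →L[ℝ] Euc n →L[ℝ] ℝ) :
    ∑ i, ∑ j, (metricOf ε e p)⁻¹ i j *
        Q (EuclideanSpace.single i 1) (EuclideanSpace.single j 1) =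
      ∑ i, Q (EuclideanSpace.single i 1) (EuclideanSpace.single i 1) -
      (ε ^ 2 / (1 + ε ^ 2)) * Q e e -
      (1 + inner ℝ p (raise (ε ^ 2 / (1 + ε ^ 2)) e p))⁻¹ *
        Q (raise (ε ^ 2 / (1 + ε ^ 2)) e p) (raise (ε ^ 2 / (1 + ε ^ 2)) e p) := by
  rw [metricOf_inv he, bilin_apply_eq_sum Q e e, bilin_apply_eq_sum Q (raise _ e p) (raise _ e p)]
  simp only [Matrix.sub_apply, Matrix.smul_apply, Matrix.vecMulVec_apply, smul_eq_mul, sub_mul,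
    Finset.sum_sub_distrib, Finset.mul_sum, mul_assoc, Matrix.one_apply, ite_mul, one_mul,
    zero_mul, Finset.sum_ite_eq, Finset.mem_univ, if_true]

/-! ### Barriers built from the level sets of a function -/

/-- The squared norm of `dF` with respect to `1 - κ e ⊗ e`. -/
def gradSq (κ : ℝ) (e : Euc n) (F : Euc n → ℝ) (x : Euc n) : ℝ :=
  inner ℝ (gradient F x) (raise κ e (gradient F x))

/-- The trace of the Hessian of `F` with respect to `1 - κ e ⊗ e`. -/
def anisoLaplacian (κ : ℝ) (e : Euc n) (F : Euc n → ℝ) (x : Euc n) : ℝ :=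
  ∑ i, fderiv ℝ (fderiv ℝ F) x (EuclideanSpace.single i 1) (EuclideanSpace.single i 1) -
    κ * fderiv ℝ (fderiv ℝ F) x e e

/-- A positive multiple of the anisotropic mean curvature of the level set of `F` through `x`. -/
def levelCurvature (κ : ℝ) (e : Euc n) (F : Euc n → ℝ) (x : Euc n) : ℝ :=
  gradSq κ e F x * anisoLaplacian κ e F x -
    fderiv ℝ (fderiv ℝ F) x (raise κ e (gradient F x)) (raise κ e (gradient F x))

theorem fderiv_eq_inner_gradient (F : Euc n → ℝ) (x X : Euc n) :
    fderiv ℝ F x X = inner ℝ (gradient F x) X := by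
  rw [gradient, InnerProductSpace.toDual_symm_apply]

/-- The Hessian inequality at a point where `v + 2k√(F - δ)` has a local maximum. -/
theorem fderiv_eq_and_hessian_le {v F : Euc n → ℝ} {x : Euc n} {k δ : ℝ}
    (hv : ContDiffAt ℝ 2 v x) (hF : ContDiffAt ℝ 2 F x) (hδ : δ < F x)
    (hmax : IsLocalMax (fun y => v y + 2 * k * √(F y - δ)) x) (X : Euc n) :
    fderiv ℝ v x X = -(k / √(F x - δ)) * fderiv ℝ F x X ∧
    fderiv ℝ (fderiv ℝ v) x X X + k / √(F x - δ) * fderiv ℝ (fderiv ℝ F) x X X -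
      k / (2 * √(F x - δ) ^ 3) * fderiv ℝ F x X ^ 2 ≤ 0 := by
  have hs : 0 < F x - δ := by linarith
  set r := √(F x - δ) with hr
  have hr0 : 0 < r := Real.sqrt_pos.2 hs
  have hpos : ∀ᶠ t in 𝓝 (0 : ℝ), 0 < F (x + t • X) - δ := by
    have : ∀ᶠ y in 𝓝 x, 0 < F y - δ :=
      (hF.continuousAt.sub continuousAt_const).eventually (lt_mem_nhds hs)
    exact (tendsto_line x X).eventually this
  have h1 : ∀ᶠ t in 𝓝 (0 : ℝ), HasDerivAt (fun t : ℝ => v (x + t • X) + 2 * k * √(F (x + t • X) - δ))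
      (fderiv ℝ v (x + t • X) X +
        2 * k * (fderiv ℝ F (x + t • X) X / (2 * √(F (x + t • X) - δ)))) t := by
    filter_upwards [eventually_hasDerivAt_comp_line hv X, eventually_hasDerivAt_comp_line hF X,
      hpos] with t h1 h2 h3
    exact h1.add (((h2.sub_const δ).sqrt h3.ne').const_mul _)
  have hF1 := (eventually_hasDerivAt_comp_line hF X).self_of_nhds.sub_const δ
  have hsq := hF1.sqrt (by simpa using hs.ne')
  have h2 := (hasDerivAt_fderiv_comp_line hv X).add
    (((hasDerivAt_fderiv_comp_line hF X).div (hsq.const_mul 2) (by simpa using hr0.ne')).const_mul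
      (2 * k))
  obtain ⟨h3, h4⟩ := deriv_eq_zero_and_nonpos_of_isLocalMax h1 h2 (isLocalMax_comp_line hmax X)
  simp only [zero_smul, add_zero, ← hr] at h3 h4
  constructor
  · have : 2 * k * (fderiv ℝ F x X / (2 * r)) = k / r * fderiv ℝ F x X := by field_simp
    linarith
  · refine le_trans (le_of_eq ?_) h4
    field_simp
    ring

theorem sum_fderiv_single_sq (F : Euc n → ℝ) (x : Euc n) :
    ∑ i, fderiv ℝ F x (EuclideanSpace.single i 1) * fderiv ℝ F x (EuclideanSpace.single i 1) =
      ‖gradient F x‖ ^ 2 := by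
  rw [EuclideanSpace.norm_sq_eq]
  refine Finset.sum_congr rfl fun i _ => ?_
  rw [fderiv_eq_inner_gradient, EuclideanSpace.inner_single_right]
  simp [sq]

/-- A solution cannot touch the barrier from below at an interior point. -/
theorem not_isLocalMax_of_barrier {v F : Euc n → ℝ} {x e : Euc n} {k δ ε : ℝ} (he : ‖e‖ = 1)
    (hv : ContDiffAt ℝ 2 v x) (hF : ContDiffAt ℝ 2 F x) (hδ : δ < F x) (hk : 0 < k)
    (hsys : ∑ i, ∑ j, (metricOf ε e (gradient v x))⁻¹ i j *
      fderiv ℝ (fderiv ℝ v) x (EuclideanSpace.single i 1) (EuclideanSpace.single j 1) = 0)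
    (hbar : gradSq (ε ^ 2 / (1 + ε ^ 2)) e F x / 2 -
      (F x - δ) * anisoLaplacian (ε ^ 2 / (1 + ε ^ 2)) e F x <
        k ^ 2 * levelCurvature (ε ^ 2 / (1 + ε ^ 2)) e F x) :
    ¬ IsLocalMax (fun y => v y + 2 * k * √(F y - δ)) x := by
  intro hmax
  have hs : 0 < F x - δ := by linarith
  have hC := fun X => fderiv_eq_and_hessian_le hv hF hδ hmax X
  have hr2 : √(F x - δ) ^ 2 = F x - δ := Real.sq_sqrt hs.le
  have hr0 : 0 < √(F x - δ) := Real.sqrt_pos.2 hs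
  set r := √(F x - δ) with hr
  set G := gradient F x with hG
  -- At the touching point the gradient of `v` is that of the barrier, so the coefficients of the
  -- equation are expressed through `F` alone.
  have hp : gradient v x = (-(k / r)) • G := by
    refine ext_inner_right ℝ fun X => ?_
    rw [← fderiv_eq_inner_gradient, (hC X).1, inner_smul_left, fderiv_eq_inner_gradient]
    simp [hG]
  have hκ1 : ε ^ 2 / (1 + ε ^ 2) ≤ 1 := by rw [div_le_one (by positivity)]; linarith
  set κ := ε ^ 2 / (1 + ε ^ 2) with hκ
  have hraise : raise κ e (gradient v x) = (-(k / r)) • raise κ e G := by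
    rw [hp, raise, raise, inner_smul_right, smul_sub, smul_smul]
    congr 2
    ring
  have hN0 : 0 ≤ gradSq κ e F x := inner_raise_nonneg hκ1 he G
  have hGN : inner ℝ G (raise κ e G) = gradSq κ e F x := rfl
  let D := fderiv ℝ F x
  -- The Hessian of `v + 2k√(F - δ)`. Contracted with the inverse metric, its `v` part vanishes by
  -- the equation.
  let Q : Euc n →L[ℝ] Euc n →L[ℝ] ℝ := fderiv ℝ (fderiv ℝ v) x +
    ((k / r) • fderiv ℝ (fderiv ℝ F) x - (k / (2 * r ^ 3)) • D.smulRight D)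
  have hQ : ∀ X, Q X X ≤ 0 := fun X => by
    refine le_trans (le_of_eq ?_) (hC X).2
    simp [Q, D]
    ring
  have h1 := sum_mul_nonpos (metricOf_posDef ε e (gradient v x)).inv.posSemidef Q hQ
  have h2 : ∀ X Y, Q X Y = fderiv ℝ (fderiv ℝ v) x X Y +
    ((k / r) • fderiv ℝ (fderiv ℝ F) x - (k / (2 * r ^ 3)) • D.smulRight D) X Y := fun X Y => rfl
  simp only [h2, mul_add, Finset.sum_add_distrib, hsys, zero_add] at h1
  rw [sum_metricOf_inv_mul he, ← hκ, hraise, hp, inner_smul_left, inner_smul_right, hGN] at h1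
  have hDe : D e = inner ℝ e G := by
    rw [real_inner_comm]; exact fderiv_eq_inner_gradient F x e
  have hDG : D (raise κ e G) = gradSq κ e F x := fderiv_eq_inner_gradient F x _
  have hN : gradSq κ e F x = ‖G‖ ^ 2 - κ * inner ℝ e G ^ 2 := inner_raise κ e G
  have hS : ∑ i, D (EuclideanSpace.single i 1) * D (EuclideanSpace.single i 1) = ‖G‖ ^ 2 :=
    sum_fderiv_single_sq F x
  simp only [sub_apply, smul_apply, ContinuousLinearMap.smulRight_apply, smul_eq_mul, map_smul,
    Finset.sum_sub_distrib, ← Finset.mul_sum, hS, hDe, hDG] at h1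
  have hKdef : levelCurvature κ e F x = gradSq κ e F x * anisoLaplacian κ e F x -
    fderiv ℝ (fderiv ℝ F) x (raise κ e G) (raise κ e G) := rfl
  have hLdef : anisoLaplacian κ e F x =
    ∑ i, fderiv ℝ (fderiv ℝ F) x (EuclideanSpace.single i 1) (EuclideanSpace.single i 1) -
      κ * fderiv ℝ (fderiv ℝ F) x e e := rfl
  set N := gradSq κ e F x
  set A := ∑ i, fderiv ℝ (fderiv ℝ F) x (EuclideanSpace.single i 1) (EuclideanSpace.single i 1)
  set Fee := fderiv ℝ (fderiv ℝ F) x e e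
  set FG := fderiv ℝ (fderiv ℝ F) x (raise κ e G) (raise κ e G)
  set a := inner ℝ e G
  set g := ‖G‖ ^ 2
  set Lp := anisoLaplacian κ e F x
  rw [hKdef, ← hr2] at hbar
  have hc : 0 < 1 + k ^ 2 / r ^ 2 * N := by positivity
  have hcc : (starRingEnd ℝ) (-(k / r)) = -(k / r) := rfl
  rw [hcc] at h1
  have hc' : 1 + -(k / r) * (-(k / r) * N) = 1 + k ^ 2 / r ^ 2 * N := by ring
  rw [hc'] at h1
  -- Clearing the denominator `1 + k²N/r²` leaves `-k/r³` times this expression; its sign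
  -- contradicts `hbar`.
  have h3 : 0 ≤ N / 2 - r ^ 2 * Lp - k ^ 2 * (N * Lp - FG) := by
    have h4 := mul_nonpos_of_nonpos_of_nonneg h1 hc.le
    have hg : g = N + κ * a ^ 2 := by linarith
    have hA : A = Lp + κ * Fee := by linarith
    rw [hg, hA, sub_mul, mul_right_comm, inv_mul_cancel₀ hc.ne'] at h4
    have h5 : (-(k / r ^ 3)) * (N / 2 - r ^ 2 * Lp - k ^ 2 * (N * Lp - FG)) ≤ 0 := by
      refine le_trans (le_of_eq ?_) h4
      field_simp
      ring
    have h6 : 0 < k / r ^ 3 := by positivity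
    by_contra! h7
    nlinarith
  linarith

/-- Comparison with the barrier `C - 2k√(F - δ)`, whose normal derivative is infinite on
`{F = δ}`. -/
theorem le_barrier {U : Set (Euc n)} (hU : IsOpen U) (hUb : Bornology.IsBounded U)
    {v F : Euc n → ℝ} {e : Euc n} {k δ ε C : ℝ} (he : ‖e‖ = 1) (hk : 0 < k)
    (hv : ContDiffOn ℝ 2 v U) (hvc : ContinuousOn v (closure U)) (hF : ContDiff ℝ 2 F)
    (hsys : ∀ x ∈ U, ∑ i, ∑ j, (metricOf ε e (gradient v x))⁻¹ i j *
      fderiv ℝ (fderiv ℝ v) x (EuclideanSpace.single i 1) (EuclideanSpace.single j 1) = 0)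
    (hbar : ∀ x ∈ U, δ ≤ F x → gradSq (ε ^ 2 / (1 + ε ^ 2)) e F x / 2 -
      (F x - δ) * anisoLaplacian (ε ^ 2 / (1 + ε ^ 2)) e F x <
        k ^ 2 * levelCurvature (ε ^ 2 / (1 + ε ^ 2)) e F x)
    (hbd : ∀ x ∈ closure U, x ∉ U → δ ≤ F x → v x + 2 * k * √(F x - δ) ≤ C) :
    ∀ x ∈ U, δ ≤ F x → v x + 2 * k * √(F x - δ) ≤ C := by
  intro x₁ hx₁ hx₁δ
  have hFc := hF.continuous
  have hK : IsCompact (closure U ∩ {x | δ ≤ F x}) :=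
    hUb.isCompact_closure.inter_right (isClosed_le continuous_const hFc)
  have hcont : ContinuousOn (fun y => v y + 2 * k * √(F y - δ)) (closure U ∩ {x | δ ≤ F x}) :=
    (hvc.mono Set.inter_subset_left).add (by fun_prop)
  obtain ⟨x, ⟨hxU, hxδ⟩, hx⟩ := hK.exists_isMaxOn ⟨x₁, subset_closure hx₁, hx₁δ⟩ hcont
  refine (hx ⟨subset_closure hx₁, hx₁δ⟩).trans ?_
  by_cases hxU' : x ∈ U
  swap
  · exact hbd x hxU hxU' hxδ
  exfalso
  have hvx : ContDiffAt ℝ 2 v x := hv.contDiffAt (hU.mem_nhds hxU')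
  have hδx : δ ≤ F x := hxδ
  rcases hδx.lt_or_eq with hlt | heq
  · refine not_isLocalMax_of_barrier he hvx hF.contDiffAt hlt hk (hsys x hxU') (hbar x hxU' hδx) ?_
    filter_upwards [hU.mem_nhds hxU', hFc.continuousAt.eventually (lt_mem_nhds hlt)] with y hy hy'
    exact hx ⟨subset_closure hy, le_of_lt hy'⟩
  -- On `{F = δ}` a vanishing gradient would turn `hbar` into `0 < 0`. Moving from `x` along the
  -- gradient enters `{F > δ}`, where the square root outgrows any linear decrease of `v`.
  · have hG : gradient F x ≠ 0 := by
      intro h0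
      have := hbar x hxU' hδx
      simp [levelCurvature, gradSq, h0, raise, ← heq] at this
    set G := gradient F x
    have hc : 0 < fderiv ℝ F x G := by
      rw [fderiv_eq_inner_gradient, real_inner_self_eq_norm_sq]
      exact pow_pos (norm_pos_iff.2 hG) 2
    have h1 := (eventually_hasDerivAt_comp_line hvx G).self_of_nhds
    have h2 := (eventually_hasDerivAt_comp_line hF.contDiffAt (x := x) G).self_of_nhds.sub_const δ
    simp only [zero_smul, add_zero] at h1 h2
    refine not_eventually_add_sqrt_le hk h1 h2 (by simp [heq]) hc ?_
    have hslope := h2.tendsto_slope_zero_right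
    simp only [zero_add, zero_smul, add_zero, ← heq, sub_self, sub_zero, smul_eq_mul] at hslope
    filter_upwards [hslope.eventually (lt_mem_nhds hc), self_mem_nhdsWithin,
      nhdsWithin_le_nhds ((tendsto_line x G).eventually (hU.mem_nhds hxU'))] with t ht ht0 htU
    have ht0 : 0 < t := ht0
    have h4 : 0 < F (x + t • G) - δ := (pos_iff_pos_of_mul_pos ht).1 (inv_pos.2 ht0)
    have := hx (⟨subset_closure htU, by simp only [Set.mem_ofPred_eq]; linarith⟩ :
      x + t • G ∈ closure U ∩ {x | δ ≤ F x})
    simpa [← heq] using this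

/-- The inner product as a bilinear form. -/
def innerForm (n : ℕ) : Euc n →L[ℝ] Euc n →L[ℝ] ℝ := innerSL ℝ

theorem innerForm_apply (X Y : Euc n) : innerForm n X Y = inner ℝ X Y := rfl

/-- The weak maximum principle. -/
theorem nonpos_of_maximum_principle {U : Set (Euc n)} (hn : 0 < n) (hU : IsOpen U)
    (hUb : Bornology.IsBounded U) {w : Euc n → ℝ} {P : Euc n → Matrix (Fin n) (Fin n) ℝ}
    (hw : ContDiffOn ℝ 2 w U) (hwc : ContinuousOn w (closure U))
    (hP : ∀ x ∈ U, (P x).PosDef)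
    (hsys : ∀ x ∈ U, ∑ i, ∑ j, P x i j *
      fderiv ℝ (fderiv ℝ w) x (EuclideanSpace.single i 1) (EuclideanSpace.single j 1) = 0)
    (hbd : ∀ x ∈ frontier U, w x ≤ 0) : ∀ x ∈ U, w x ≤ 0 := by
  intro x₁ hx₁
  by_contra! hpos
  obtain ⟨R, hR⟩ := hUb.closure.exists_norm_le
  have hR0 : 0 ≤ R := (norm_nonneg _).trans (hR x₁ (subset_closure hx₁))
  -- Adding `η‖y‖²` makes the operator strictly positive, by `2η` times the trace of `P`; `η` is
  -- small enough to keep the maximum off the boundary.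
  obtain ⟨η, hη, hηR⟩ : ∃ η > 0, η * R ^ 2 < w x₁ := by
    refine ⟨w x₁ / (2 * (R ^ 2 + 1)), by positivity, ?_⟩
    rw [div_mul_eq_mul_div, div_lt_iff₀ (by positivity)]
    nlinarith [sq_nonneg R]
  have hcont : ContinuousOn (fun y => w y + η * ‖y‖ ^ 2) (closure U) := hwc.add (by fun_prop)
  obtain ⟨x, hxU, hx⟩ := hUb.isCompact_closure.exists_isMaxOn ⟨x₁, subset_closure hx₁⟩ hcont
  have hxU' : x ∈ U := by
    by_contra hxn
    have h1 := hbd x ⟨hxU, by rwa [hU.interior_eq]⟩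
    have h2 : w x₁ + η * ‖x₁‖ ^ 2 ≤ w x + η * ‖x‖ ^ 2 := hx (subset_closure hx₁)
    have h3 : ‖x‖ ^ 2 ≤ R ^ 2 := pow_le_pow_left₀ (norm_nonneg _) (hR x hxU) 2
    nlinarith [sq_nonneg ‖x₁‖]
  have hwx : ContDiffAt ℝ 2 w x := hw.contDiffAt (hU.mem_nhds hxU')
  have hmax : IsLocalMax (fun y => w y + η * ‖y‖ ^ 2) x := by
    filter_upwards [hU.mem_nhds hxU'] with y hy using hx (subset_closure hy)
  let Q : Euc n →L[ℝ] Euc n →L[ℝ] ℝ := fderiv ℝ (fderiv ℝ w) x + (2 * η) • innerForm n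
  have hQ : ∀ X, Q X X ≤ 0 := by
    intro X
    have hsq : ∀ t : ℝ, HasDerivAt (fun t : ℝ => η * ‖x + t • X‖ ^ 2)
        (η * (2 * inner ℝ (x + t • X) X)) t := fun t =>
      (hasDerivAt_line x X t).norm_sq.const_mul η
    have h1 : ∀ᶠ t in 𝓝 (0 : ℝ), HasDerivAt (fun t : ℝ => w (x + t • X) + η * ‖x + t • X‖ ^ 2)
        (fderiv ℝ w (x + t • X) X + η * (2 * inner ℝ (x + t • X) X)) t := by
      filter_upwards [eventually_hasDerivAt_comp_line hwx X] with t ht using ht.add (hsq t)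
    have h2 := (hasDerivAt_fderiv_comp_line hwx X).add
      ((((hasDerivAt_line x X 0).inner ℝ (hasDerivAt_const (0 : ℝ) X)).const_mul 2).const_mul η)
    have h3 := (deriv_eq_zero_and_nonpos_of_isLocalMax h1 h2 (isLocalMax_comp_line hmax X)).2
    refine le_trans (le_of_eq ?_) h3
    simp [Q, innerForm_apply]
    ring
  have h1 := sum_mul_nonpos (hP x hxU').posSemidef Q hQ
  have h2 : ∀ X Y, Q X Y = fderiv ℝ (fderiv ℝ w) x X Y + 2 * η * inner ℝ X Y := fun X Y => rfl
  simp only [h2, mul_add, Finset.sum_add_distrib, hsys x hxU', zero_add] at h1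
  have : Nonempty (Fin n) := ⟨⟨0, hn⟩⟩
  have htr := (hP x hxU').trace_pos
  have h3 : ∑ i, ∑ j, P x i j * (2 * η * inner ℝ (EuclideanSpace.single i (1 : ℝ) : Euc n)
      (EuclideanSpace.single j 1)) = 2 * η * (P x).trace := by
    simp [Matrix.trace, Finset.mul_sum, EuclideanSpace.inner_single_left, mul_comm]
  rw [h3] at h1
  have : 0 < 2 * η * (P x).trace := by positivity
  linarith

/-! ### Geometry of the boundary at a nonconvex minimal point -/

theorem hessian_symm {f : Euc n → ℝ} (hf : ContDiff ℝ ∞ f) (p X Y : Euc n) :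
    fderiv ℝ (fderiv ℝ f) p X Y = fderiv ℝ (fderiv ℝ f) p Y X :=
  ((contDiff_infty.1 hf 2).contDiffAt.isSymmSndFDerivAt (by simp)) X Y

/-- Otherwise the form is negative semidefinite with trace zero on the tangent space. All its
diagonal entries vanish, and null vectors of a semidefinite form lie in its kernel, so it is zero,
contradicting the negative value. -/
theorem exists_tangent_hessian_pos {f : Euc n → ℝ} {p : Euc n} (hf : ContDiff ℝ ∞ f)
    (hdf : fderiv ℝ f p ≠ 0) (hH : meanCurvature f p = 0)
    (hX : ∃ X : tangentHyperplane f p, secondFundamentalForm f p X X < 0) :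
    ∃ e : Euc n, ‖e‖ = 1 ∧ fderiv ℝ f p e = 0 ∧ 0 < fderiv ℝ (fderiv ℝ f) p e e := by
  obtain ⟨X, hX⟩ := hX
  have hpos : 0 < ‖fderiv ℝ f p‖ := norm_pos_iff.2 hdf
  let Q := fderiv ℝ (fderiv ℝ f) p
  have hsymm : ∀ X Y, Q X Y = Q Y X := hessian_symm hf p
  by_contra! hcon
  have hneg : ∀ Y : tangentHyperplane f p, Q Y Y ≤ 0 := by
    intro Y
    by_contra! hY
    have hY0 : (Y : Euc n) ≠ 0 := by
      rintro h0
      simp [h0] at hY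
    have h0 : 0 < ‖(Y : Euc n)‖ := norm_pos_iff.2 hY0
    have hYk : fderiv ℝ f p (Y : Euc n) = 0 := Y.2
    have h1 := hcon (‖(Y : Euc n)‖⁻¹ • (Y : Euc n)) (by rw [norm_smul]; simp [h0.ne'])
      (by simp [hYk])
    have h2 : 0 < Q (‖(Y : Euc n)‖⁻¹ • (Y : Euc n)) (‖(Y : Euc n)‖⁻¹ • (Y : Euc n)) := by
      simp only [map_smul, smul_apply, smul_eq_mul]
      positivity
    exact absurd h1 (not_le.2 h2)
  have hnull : ∀ Y Z : tangentHyperplane f p, Q Y Y = 0 → Q Y Z = 0 := by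
    intro Y Z hY
    by_contra hYZ
    -- The coefficient is chosen so that `Q` takes the value `1` on this vector.
    have h1 := hneg (Z + ((1 - Q Z Z) / (2 * Q Y Z)) • Y)
    simp only [Submodule.coe_add, Submodule.coe_smul, map_add, map_smul, add_apply, smul_apply,
      smul_eq_mul, hY, hsymm (Z : Euc n) Y] at h1
    have h2 : (1 - Q Z Z) / (2 * Q Y Z) * Q Y Z = (1 - Q Z Z) / 2 := by field_simp
    rw [mul_zero, add_zero, h2] at h1
    linarith
  let b := stdOrthonormalBasis ℝ (tangentHyperplane f p)
  have hb : ∀ i, Q (b i) (b i) = 0 := by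
    have hsum : ∑ i, Q (b i) (b i) = 0 := by
      have h2 : (∑ i, Q (b i) (b i)) / ‖fderiv ℝ f p‖ = 0 := by
        rw [Finset.sum_div]; exact hH
      exact (div_eq_zero_iff.1 h2).resolve_right hpos.ne'
    intro i
    exact (Finset.sum_eq_zero_iff_of_nonpos fun i _ => hneg (b i)).1 hsum i (Finset.mem_univ i)
  have hXX : Q X X = 0 := by
    have hX' : (X : Euc n) = ∑ i, b.repr X i • (b i : Euc n) := by
      conv_lhs => rw [← b.sum_repr X]
      simp
    have : Q X X = ∑ i, b.repr X i * Q (b i) X := by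
      conv_lhs =>
        arg 1
        rw [hX']
      simp
    rw [this]
    exact Finset.sum_eq_zero fun i _ => by rw [hnull _ _ (hb i), mul_zero]
  have : Q X X / ‖fderiv ℝ f p‖ < 0 := hX
  rw [hXX, zero_div] at this
  exact lt_irrefl _ this

/-- The full trace is computed in the orthonormal frame `c` made of the unit normal (`none`) and a
tangent basis (`some i`). -/
theorem sum_hessian_eq {f : Euc n → ℝ} {p : Euc n} (hdf : fderiv ℝ f p ≠ 0) :
    ∑ j, fderiv ℝ (fderiv ℝ f) p (EuclideanSpace.single j 1) (EuclideanSpace.single j 1) =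
      ‖fderiv ℝ f p‖ * meanCurvature f p + (‖gradient f p‖ ^ 2)⁻¹ *
        fderiv ℝ (fderiv ℝ f) p (gradient f p) (gradient f p) := by
  have hpos : 0 < ‖fderiv ℝ f p‖ := norm_pos_iff.2 hdf
  set G := gradient f p with hG
  have hG0 : G ≠ 0 := by
    intro h0
    apply hdf
    ext X
    rw [fderiv_eq_inner_gradient, ← hG, h0]
    simp
  have hGpos : 0 < ‖G‖ := norm_pos_iff.2 hG0
  let b := stdOrthonormalBasis ℝ (tangentHyperplane f p)
  let c : Option (Fin (Module.finrank ℝ (tangentHyperplane f p))) → Euc n :=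
    fun o => o.elim (‖G‖⁻¹ • G) fun i => (b i : Euc n)
  have hbG : ∀ Y : tangentHyperplane f p, inner ℝ (Y : Euc n) G = 0 := by
    intro Y
    rw [real_inner_comm, hG, ← fderiv_eq_inner_gradient]
    exact Y.2
  have hc : ∀ x, x = ∑ i, inner ℝ (c i) x • c i := by
    intro x
    have hy : x - (‖G‖ ^ 2)⁻¹ • inner ℝ G x • G ∈ tangentHyperplane f p := by
      change fderiv ℝ f p _ = 0
      rw [fderiv_eq_inner_gradient, ← hG, inner_sub_right, inner_smul_right, inner_smul_right,
        real_inner_self_eq_norm_sq]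
      field_simp
      ring
    have h1 := b.sum_repr ⟨_, hy⟩
    have h2 := congrArg (fun y : tangentHyperplane f p => (y : Euc n)) h1
    simp only [Submodule.coe_sum, Submodule.coe_smul] at h2
    have h3 : ∀ i, b.repr ⟨_, hy⟩ i = inner ℝ (b i : Euc n) x := by
      intro i
      rw [b.repr_apply_apply, Submodule.coe_inner]
      simp only [inner_sub_right, inner_smul_right, hbG]
      simp
    simp only [h3] at h2
    rw [Fintype.sum_option]
    simp only [c, Option.elim]
    rw [h2, inner_smul_left, smul_smul]
    simp only [smul_smul]
    have : (starRingEnd ℝ) ‖G‖⁻¹ * inner ℝ G x * ‖G‖⁻¹ = (‖G‖ ^ 2)⁻¹ * inner ℝ G x := by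
      simp; ring
    rw [this]
    abel
  rw [sum_single_eq _ c hc, Fintype.sum_option]
  have h4 : ‖fderiv ℝ f p‖ * meanCurvature f p =
      ∑ i, fderiv ℝ (fderiv ℝ f) p (b i : Euc n) (b i : Euc n) := by
    simp only [meanCurvature, secondFundamentalForm, ← Finset.sum_div]
    rw [mul_div_cancel₀ _ hpos.ne']
  rw [h4, add_comm]
  simp only [c, Option.elim, map_smul, smul_apply, smul_eq_mul]
  ring

/-- Since `e` is tangent, `raise` fixes the gradient and the normal-normal Hessian terms cancel.
With `H = 0` only the tilt contribution remains, and it has the sign opposite to `II(e, e)`. -/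
theorem levelCurvature_eq {f : Euc n → ℝ} {p e : Euc n} {κ : ℝ} (hdf : fderiv ℝ f p ≠ 0)
    (hH : meanCurvature f p = 0) (he : fderiv ℝ f p e = 0) :
    levelCurvature κ e f p = -(κ * ‖gradient f p‖ ^ 2 * fderiv ℝ (fderiv ℝ f) p e e) := by
  have hG0 : gradient f p ≠ 0 := by
    intro h0
    apply hdf
    ext X
    rw [fderiv_eq_inner_gradient, h0]
    simp
  have hGpos : 0 < ‖gradient f p‖ := norm_pos_iff.2 hG0
  have hr : raise κ e (gradient f p) = gradient f p := by
    rw [raise, real_inner_comm, ← fderiv_eq_inner_gradient, he]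
    simp
  rw [levelCurvature, gradSq, anisoLaplacian, sum_hessian_eq hdf, hr, hH,
    real_inner_self_eq_norm_sq]
  field_simp
  ring

theorem gradient_fun_neg (f : Euc n → ℝ) (p : Euc n) :
    gradient (fun x => -f x) p = -gradient f p := by
  simp [gradient, fderiv_fun_neg]

/-- Barriers live where `F > δ`, so near `q` they use `F = -f`, positive inside the domain; negative
curvature for `f` becomes the positive one that `le_barrier` needs. -/
theorem levelCurvature_neg (f : Euc n → ℝ) (κ : ℝ) (e p : Euc n) :
    levelCurvature κ e (fun x => -f x) p = -levelCurvature κ e f p := by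
  have h1 : fderiv ℝ (fun x => -f x) = fun x => -fderiv ℝ f x := by
    ext1 x; exact fderiv_fun_neg
  have h2 : raise κ e (-gradient f p) = -raise κ e (gradient f p) := by
    simp only [raise, inner_neg_right, mul_neg, neg_smul]
    abel
  simp only [levelCurvature, gradSq, anisoLaplacian, gradient_fun_neg, h1, fderiv_fun_neg, h2,
    inner_neg_neg, map_neg, neg_apply, neg_neg, Finset.sum_neg_distrib]
  ring

theorem continuous_barrier_terms {F : Euc n → ℝ} (hF : ContDiff ℝ 2 F) (κ : ℝ) (e : Euc n) :
    Continuous (gradSq κ e F) ∧ Continuous (anisoLaplacian κ e F) ∧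
      Continuous (levelCurvature κ e F) := by
  have h1 : Continuous (fderiv ℝ F) := hF.continuous_fderiv (by norm_num)
  have h2 : Continuous (fderiv ℝ (fderiv ℝ F)) :=
    (hF.fderiv_right (m := 1) (by norm_num)).continuous_fderiv (by norm_num)
  have h3 : Continuous (gradient F) :=
    (InnerProductSpace.toDual ℝ (Euc n)).symm.continuous.comp h1
  have h4 : Continuous fun x => raise κ e (gradient F x) := by
    unfold raise; fun_prop
  have h5 : Continuous (gradSq κ e F) := h3.inner h4
  have h6 : Continuous (anisoLaplacian κ e F) := by
    unfold anisoLaplacian; fun_prop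
  refine ⟨h5, h6, (h5.mul h6).sub ?_⟩
  exact (h2.clm_apply h4).clm_apply h4

/-! ### Level sets adapted to the metric `1 + ε² e ⊗ e` -/

/-- The squared distance to `q` in the metric `1 + ε² e ⊗ e`. -/
def anisoDistSq (ε : ℝ) (e q x : Euc n) : ℝ := ‖x - q‖ ^ 2 + ε ^ 2 * inner ℝ e (x - q) ^ 2

theorem contDiff_anisoDistSq (ε : ℝ) (e q : Euc n) : ContDiff ℝ 2 (anisoDistSq ε e q) := by
  unfold anisoDistSq
  exact ((contDiff_id.sub contDiff_const).norm_sq ℝ).add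
    (contDiff_const.mul ((contDiff_const.inner ℝ (contDiff_id.sub contDiff_const)).pow 2))

/-- The bilinear form `2 (1 + ε² e ⊗ e)`, the Hessian of `anisoDistSq`. -/
def anisoForm (ε : ℝ) (e : Euc n) : Euc n →L[ℝ] Euc n →L[ℝ] ℝ :=
  (2 : ℝ) • innerForm n +
    (2 * ε ^ 2) • (innerSL ℝ e).smulRight (innerSL ℝ e)

theorem anisoForm_apply (ε : ℝ) (e X Y : Euc n) :
    anisoForm ε e X Y = 2 * inner ℝ X Y + 2 * ε ^ 2 * (inner ℝ e X * inner ℝ e Y) := rfl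

theorem fderiv_anisoDistSq (ε : ℝ) (e q : Euc n) :
    fderiv ℝ (anisoDistSq ε e q) = fun x => anisoForm ε e (x - q) := by
  ext x X
  have hd : DifferentiableAt ℝ (anisoDistSq ε e q) x :=
    (contDiff_anisoDistSq ε e q).differentiable (by norm_num) x
  have hl : HasDerivAt (fun t : ℝ => x + t • X - q) X 0 := (hasDerivAt_line x X 0).sub_const q
  have h1 : HasDerivAt (fun t : ℝ => anisoDistSq ε e q (x + t • X))
      (2 * inner ℝ (x + (0 : ℝ) • X - q) X +
        ε ^ 2 * (2 * inner ℝ e (x + (0 : ℝ) • X - q) * inner ℝ e X)) 0 := by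
    have h3 := ((hasDerivAt_const (0 : ℝ) e).inner ℝ hl).pow 2
    refine (hl.norm_sq.add (h3.const_mul (ε ^ 2))).congr_deriv ?_
    simp
  have h2 : HasDerivAt (fun t : ℝ => anisoDistSq ε e q (x + t • X))
      (fderiv ℝ (anisoDistSq ε e q) x X) 0 := by
    have h3 : HasFDerivAt (anisoDistSq ε e q) (fderiv ℝ (anisoDistSq ε e q) x)
      (x + (0 : ℝ) • X) := by simpa using hd.hasFDerivAt
    exact h3.comp_hasDerivAt (0 : ℝ) (hasDerivAt_line x X 0)
  rw [h2.unique h1, anisoForm_apply]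
  simp
  ring

theorem fderiv_fderiv_anisoDistSq (ε : ℝ) (e q x : Euc n) :
    fderiv ℝ (fderiv ℝ (anisoDistSq ε e q)) x = anisoForm ε e := by
  rw [fderiv_anisoDistSq]
  exact ((anisoForm ε e).hasFDerivAt.comp x ((hasFDerivAt_id x).sub_const q)).fderiv

/-- In a constant metric the metric gradient of the squared distance is twice the position vector;
the `e` terms cancel because `κ(1 + ε²) = ε²`. -/
theorem raise_gradient_anisoDistSq {ε : ℝ} {e : Euc n} (he : ‖e‖ = 1) (q x : Euc n) :
    raise (ε ^ 2 / (1 + ε ^ 2)) e (gradient (anisoDistSq ε e q) x) = (2 : ℝ) • (x - q) := by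
  have hG : gradient (anisoDistSq ε e q) x =
      (2 : ℝ) • (x - q) + (2 * ε ^ 2 * inner ℝ e (x - q)) • e := by
    refine ext_inner_right ℝ fun X => ?_
    rw [← fderiv_eq_inner_gradient, fderiv_anisoDistSq, anisoForm_apply, inner_add_left,
      inner_smul_left, inner_smul_left]
    simp
    ring
  have h1 : (1 + ε ^ 2) ≠ 0 := by positivity
  rw [raise, hG, inner_add_right, inner_smul_right, inner_smul_right, real_inner_self_eq_norm_sq,
    he, add_sub_assoc, ← sub_smul]
  have : 2 * ε ^ 2 * inner ℝ e (x - q) - ε ^ 2 / (1 + ε ^ 2) *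
      (2 * inner ℝ e (x - q) + 2 * ε ^ 2 * inner ℝ e (x - q) * 1 ^ 2) = 0 := by
    field_simp
    ring
  rw [this, zero_smul, add_zero]

/-- A linear change of coordinates turns these into the values for `|y|²` in Euclidean space, the
last being `4ρ · 2n - 8ρ`. -/
theorem barrier_terms_anisoDistSq {ε : ℝ} {e : Euc n} (he : ‖e‖ = 1) (q x : Euc n) :
    gradSq (ε ^ 2 / (1 + ε ^ 2)) e (anisoDistSq ε e q) x = 4 * anisoDistSq ε e q x ∧
    anisoLaplacian (ε ^ 2 / (1 + ε ^ 2)) e (anisoDistSq ε e q) x = 2 * n ∧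
    levelCurvature (ε ^ 2 / (1 + ε ^ 2)) e (anisoDistSq ε e q) x =
      8 * (n - 1) * anisoDistSq ε e q x := by
  have h1 : gradSq (ε ^ 2 / (1 + ε ^ 2)) e (anisoDistSq ε e q) x = 4 * anisoDistSq ε e q x := by
    rw [gradSq, raise_gradient_anisoDistSq he, ← fderiv_eq_inner_gradient, fderiv_anisoDistSq,
      anisoForm_apply, inner_smul_right, inner_smul_right, real_inner_self_eq_norm_sq, anisoDistSq]
    ring
  have h2 : anisoLaplacian (ε ^ 2 / (1 + ε ^ 2)) e (anisoDistSq ε e q) x = 2 * n := by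
    have h3 : ∑ i, e i * e i = 1 := by
      have := EuclideanSpace.norm_sq_eq e
      rw [he] at this
      simpa [sq] using this.symm
    have h4 : (1 + ε ^ 2) ≠ 0 := by positivity
    simp only [anisoLaplacian, fderiv_fderiv_anisoDistSq, anisoForm_apply,
      real_inner_self_eq_norm_sq, he, EuclideanSpace.inner_single_right,
      Finset.sum_add_distrib, ← Finset.mul_sum]
    simp [h3]
    field_simp
    ring
  refine ⟨h1, h2, ?_⟩
  rw [levelCurvature, h1, h2, raise_gradient_anisoDistSq he, fderiv_fderiv_anisoDistSq,
    anisoForm_apply, inner_smul_right, inner_smul_left, inner_smul_right,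
    real_inner_self_eq_norm_sq, anisoDistSq]
  simp
  ring

/-! ### The boundary estimate -/

/-- At a boundary point where the anisotropic mean curvature is negative, a solution is bounded in
terms of its boundary values away from that point. -/
theorem exists_boundary_bound (hn : 3 ≤ n) {Ω : Set (Euc n)} (hΩ : IsOpen Ω)
    (hΩb : Bornology.IsBounded Ω) {q e : Euc n} {f : Euc n → ℝ} {ε : ℝ} (hε1 : ε ^ 2 ≤ 1)
    (he : ‖e‖ = 1) (hq : q ∈ frontier Ω) (hf : IsDefiningFunctionAt Ω q f)
    (hcurv : levelCurvature (ε ^ 2 / (1 + ε ^ 2)) e f q < 0) :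
    ∃ r > 0, ∃ C : ℝ, ∀ v : Euc n → ℝ, ContDiffOn ℝ 2 v Ω → ContinuousOn v (closure Ω) →
      (∀ x ∈ Ω, ∑ i, ∑ j, (metricOf ε e (gradient v x))⁻¹ i j *
        fderiv ℝ (fderiv ℝ v) x (EuclideanSpace.single i 1) (EuclideanSpace.single j 1) = 0) →
      (∀ x ∈ frontier Ω, r ≤ ‖x - q‖ → v x ≤ 0) → v q ≤ C := by
  set κ := ε ^ 2 / (1 + ε ^ 2) with hκ
  set F : Euc n → ℝ := fun x => -f x with hFdef
  have hF : ContDiff ℝ 2 F := (contDiff_infty.1 hf.smooth 2).neg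
  obtain ⟨hNc, hLc, hKc⟩ := continuous_barrier_terms hF κ e
  have hKq : 0 < levelCurvature κ e F q := by
    rw [hFdef, levelCurvature_neg]; linarith
  -- The absolute value absorbs the factor `F - δ`, which lies in `[0, 1)` where the barrier is
  -- used.
  obtain ⟨k, hk, hkq⟩ : ∃ k > 0, gradSq κ e F q / 2 + |anisoLaplacian κ e F q| <
      k ^ 2 * levelCurvature κ e F q := by
    have h1 := (Filter.tendsto_pow_atTop (α := ℝ) two_ne_zero).atTop_mul_const hKq
    obtain ⟨k, hk1, hk2⟩ := ((Filter.eventually_gt_atTop 0).and (h1.eventually_gt_atTop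
      (gradSq κ e F q / 2 + |anisoLaplacian κ e F q|))).exists
    exact ⟨k, hk1, hk2⟩
  have hnear : ∀ᶠ x in 𝓝 q, gradSq κ e F x / 2 + |anisoLaplacian κ e F x| <
      k ^ 2 * levelCurvature κ e F x ∧ F x < 1 ∧ (x ∈ Ω ↔ f x < 0) := by
    refine (Filter.Tendsto.eventually_lt (f := fun x => gradSq κ e F x / 2 +
      |anisoLaplacian κ e F x|) (g := fun x => k ^ 2 * levelCurvature κ e F x)
      (Continuous.tendsto (by fun_prop) q) (Continuous.tendsto (by fun_prop) q) hkq).and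
      ((hF.continuous.continuousAt.eventually (gt_mem_nhds ?_)).and hf.mem_iff)
    simp [hFdef, hf.map_eq_zero]
  obtain ⟨a, ha, hball⟩ := Metric.nhds_basis_closedBall.eventually_iff.1 hnear
  set ρ := anisoDistSq ε e q with hρ
  have hρc : ContDiff ℝ 2 ρ := contDiff_anisoDistSq ε e q
  have hρle : ∀ x, ‖x - q‖ ^ 2 ≤ ρ x := fun x =>
    le_add_of_nonneg_right (by positivity)
  have hρge : ∀ x, ρ x ≤ 2 * ‖x - q‖ ^ 2 := by
    intro x
    have h := abs_real_inner_le_norm e (x - q)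
    rw [he, one_mul] at h
    have h2 : inner ℝ e (x - q) ^ 2 ≤ ‖x - q‖ ^ 2 := by
      rw [← sq_abs]; exact pow_le_pow_left₀ (abs_nonneg _) h 2
    have h3 : ε ^ 2 * inner ℝ e (x - q) ^ 2 ≤ 1 * ‖x - q‖ ^ 2 := by gcongr
    rw [hρ, anisoDistSq]
    linarith
  obtain ⟨R, hR⟩ := hΩb.isCompact_closure.exists_bound_of_continuousOn hρc.continuous.continuousOn
  -- Since `ρ ≤ 2‖x - q‖²`, points with `ρ ≥ a²` are at distance at least `a / 2` from `q`. The two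
  -- summands come from the outer and the inner barrier.
  refine ⟨a / 2, by positivity, 2 * √R + 2 * k, fun v hv hvc hsys hbd => ?_⟩
  have hout : ∀ x ∈ Ω, a ^ 2 ≤ ρ x → v x ≤ 2 * √R := by
    intro x hx hxa
    have h1 := le_barrier (F := ρ) (k := 1) (δ := a ^ 2) (C := 2 * √R) hΩ hΩb he one_pos hv hvc hρc
      hsys ?_ ?_ x hx hxa
    · have := Real.sqrt_nonneg (ρ x - a ^ 2)
      linarith
    · intro y _ hya
      obtain ⟨h1, h2, h3⟩ := barrier_terms_anisoDistSq (ε := ε) he q y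
      rw [h1, h2, h3, ← hρ]
      have h4 : (3 : ℝ) ≤ n := by exact_mod_cast hn
      have h5 : 0 < ρ y := lt_of_lt_of_le (by positivity) hya
      have h6 : 0 ≤ (ρ y - a ^ 2) * (2 * n) := mul_nonneg (by linarith) (by linarith)
      nlinarith
    · intro y hyc hyn hya
      have h1 : v y ≤ 0 := by
        refine hbd y ⟨hyc, by rwa [hΩ.interior_eq]⟩ ?_
        by_contra! hlt
        nlinarith [hρge y, norm_nonneg (y - q)]
      have h2 : √(ρ y - a ^ 2) ≤ √R := by
        refine Real.sqrt_le_sqrt ?_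
        have := (le_abs_self _).trans (hR y hyc)
        nlinarith
      linarith
  have hU : IsOpen (Ω ∩ Metric.ball q a) := hΩ.inter Metric.isOpen_ball
  have hUc : closure (Ω ∩ Metric.ball q a) ⊆ closure Ω ∩ Metric.closedBall q a :=
    (closure_inter_subset_inter_closure _ _).trans
      (Set.inter_subset_inter_right _ Metric.closure_ball_subset_closedBall)
  have hin : ∀ x ∈ Ω ∩ Metric.ball q a, v x ≤ 2 * √R + 2 * k := by
    intro x hx
    have hFx : 0 < F x := by
      have := (hball (Metric.ball_subset_closedBall hx.2)).2.2.1 hx.1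
      simp only [hFdef]; linarith
    -- The level `δ = F x > 0` passes through `x` itself. On the closed ball `{F ≥ δ}` stays inside
    -- `Ω`, so the only boundary left is the sphere of radius `a`, where `hout` applies.
    have h1 := le_barrier (F := F) (k := k) (δ := F x) (C := 2 * √R + 2 * k) hU
      (hΩb.subset Set.inter_subset_left) he hk (hv.mono Set.inter_subset_left)
      (hvc.mono (closure_mono Set.inter_subset_left)) hF (fun y hy => hsys y hy.1) ?_ ?_ x hx le_rfl
    · simpa using h1
    · intro y hy hyδ
      obtain ⟨h2, h3, -⟩ := hball (Metric.ball_subset_closedBall hy.2)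
      refine lt_of_le_of_lt ?_ h2
      have h4 : -((F y - F x) * anisoLaplacian κ e F y) ≤ 1 * |anisoLaplacian κ e F y| := by
        refine (neg_le_abs _).trans ?_
        rw [abs_mul, abs_of_nonneg (by linarith : 0 ≤ F y - F x)]
        gcongr
        linarith
      linarith
    · intro y hyc hyn hyδ
      obtain ⟨hyc1, hyc2⟩ := hUc hyc
      obtain ⟨-, h3, h4⟩ := hball hyc2
      have hyΩ : y ∈ Ω := h4.2 (by simp only [hFdef] at hyδ hFx; linarith)
      have hya : a ≤ ‖y - q‖ := by
        by_contra! hlt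
        exact hyn ⟨hyΩ, by rwa [mem_ball_iff_norm]⟩
      have h5 := hout y hyΩ ((pow_le_pow_left₀ ha.le hya 2).trans (hρle y))
      have h6 : √(F y - F x) ≤ 1 := Real.sqrt_le_one.2 (by linarith)
      nlinarith
  have hqU : q ∈ closure (Ω ∩ Metric.ball q a) := by
    rw [Set.inter_comm]
    exact Metric.isOpen_ball.inter_closure ⟨Metric.mem_ball_self ha, hq.1⟩
  have hcw : ContinuousWithinAt v (Ω ∩ Metric.ball q a) q :=
    (hvc q hq.1).mono (Set.inter_subset_left.trans subset_closure)
  have := mem_closure_iff_nhdsWithin_neBot.1 hqU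
  exact le_of_tendsto hcw (Filter.eventually_of_mem self_mem_nhdsWithin hin)

/-! ### Reduction of the system to a scalar equation -/

theorem partialDeriv_eq (i : Fin n) (v : Euc n → ℝ) (x : Euc n) :
    partialDeriv i v x = gradient v x i := by
  rw [partialDeriv, fderiv_eq_inner_gradient, EuclideanSpace.inner_single_right]
  simp

theorem partialDeriv_partialDeriv {v : Euc n → ℝ} {x : Euc n} (hv : ContDiffAt ℝ 2 v x)
    (i j : Fin n) : partialDeriv i (partialDeriv j v) x =
      fderiv ℝ (fderiv ℝ v) x (EuclideanSpace.single i 1) (EuclideanSpace.single j 1) := by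
  have h1 := ((differentiableAt_fderiv hv).hasFDerivAt.clm_apply
    (hasFDerivAt_const (EuclideanSpace.single j (1 : ℝ)) x)).fderiv
  change fderiv ℝ (fun y => fderiv ℝ v y (EuclideanSpace.single j 1)) x _ = _
  rw [h1]
  simp

theorem graphMetric_eq {m : ℕ} (u : Euc n → Euc m) (x : Euc n) :
    graphMetric u x = 1 + ∑ α, Matrix.vecMulVec (gradient (fun y => u y α) x).ofLp
      (gradient (fun y => u y α) x).ofLp := by
  ext i j
  simp [graphMetric, partialDeriv_eq, Matrix.one_apply, Matrix.sum_apply, Matrix.vecMulVec_apply]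

theorem graphMetric_posDef {m : ℕ} (u : Euc n → Euc m) (x : Euc n) : (graphMetric u x).PosDef := by
  rw [graphMetric_eq]
  refine Matrix.PosDef.one.add_posSemidef (Matrix.posSemidef_sum _ fun α _ => ?_)
  simpa using Matrix.posSemidef_vecMulVec_self_star (gradient (fun y => u y α) x).ofLp

theorem gradient_linear (ε : ℝ) (e x : Euc n) :
    gradient (fun y => ε * inner ℝ e y) x = ε • e := by
  have h : HasFDerivAt (fun y => ε * inner ℝ e y) (ε • innerSL ℝ e) x :=
    (innerSL ℝ e).hasFDerivAt.const_mul ε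
  refine ext_inner_right ℝ fun X => ?_
  rw [← fderiv_eq_inner_gradient, h.fderiv, inner_smul_left]
  simp

theorem contDiffOn_component {m : ℕ} {Ω : Set (Euc n)} {u : Euc n → Euc m}
    (hu : ContDiffOn ℝ 2 u Ω) (α : Fin m) : ContDiffOn ℝ 2 (fun y => u y α) Ω :=
  (EuclideanSpace.proj (𝕜 := ℝ) α).contDiff.comp_contDiffOn hu

/-- A component of a solution with linear boundary values is linear. -/
theorem IsClassicalSolution.component_eq_linear {m : ℕ} {Ω : Set (Euc n)} (hn : 0 < n)
    (hΩ : IsOpen Ω) (hΩb : Bornology.IsBounded Ω) {ψ u : Euc n → Euc m}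
    (hu : IsClassicalSolution Ω ψ u) (α : Fin m) {ε : ℝ} {e : Euc n}
    (hψ : ∀ x ∈ frontier Ω, ψ x α = ε * inner ℝ e x) : ∀ x ∈ Ω, u x α = ε * inner ℝ e x := by
  have hl : ContDiff ℝ 2 (fun y : Euc n => ε * inner ℝ e y) :=
    contDiff_const.mul (contDiff_const.inner ℝ contDiff_id)
  have hc := contDiffOn_component hu.contDiffOn α
  have hcc : ContinuousOn (fun y => u y α) (closure Ω) :=
    (EuclideanSpace.proj (𝕜 := ℝ) α).continuous.comp_continuousOn hu.continuousOn
  have hl2 : ∀ x, fderiv ℝ (fderiv ℝ (fun y : Euc n => ε * inner ℝ e y)) x = 0 := by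
    intro x
    have : fderiv ℝ (fun y : Euc n => ε * inner ℝ e y) = fun _ => ε • innerSL ℝ e := by
      ext1 y
      exact ((innerSL ℝ e).hasFDerivAt.const_mul ε).fderiv
    rw [this, fderiv_fun_const]
    rfl
  -- The inverse metric of the given solution serves as a fixed coefficient matrix; the maximum
  -- principle is applied to the difference and to its negative.
  have hP : ∀ x ∈ Ω, ((graphMetric u x)⁻¹).PosDef := fun x _ => (graphMetric_posDef u x).inv
  have hH : ∀ x ∈ Ω, fderiv ℝ (fderiv ℝ fun y => u y α - ε * inner ℝ e y) x =
      fderiv ℝ (fderiv ℝ fun y => u y α) x := by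
    intro x hx
    have h0 : ContDiffAt ℝ 2 (fun y => u y α) x := hc.contDiffAt (hΩ.mem_nhds hx)
    have h1 : fderiv ℝ (fun y => u y α - ε * inner ℝ e y) =ᶠ[𝓝 x]
        fun y => fderiv ℝ (fun y => u y α) y - fderiv ℝ (fun y => ε * inner ℝ e y) y := by
      filter_upwards [h0.eventually (by simp)] with y hy
      exact fderiv_fun_sub (hy.differentiableAt (by norm_num))
        (hl.differentiable (by norm_num) y)
    rw [h1.fderiv_eq, fderiv_fun_sub (differentiableAt_fderiv h0)
      (differentiableAt_fderiv hl.contDiffAt), hl2, sub_zero]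
  have hsys : ∀ x ∈ Ω, ∑ i, ∑ j, (graphMetric u x)⁻¹ i j *
      fderiv ℝ (fderiv ℝ fun y => u y α - ε * inner ℝ e y) x (EuclideanSpace.single i 1)
        (EuclideanSpace.single j 1) = 0 := by
    intro x hx
    rw [hH x hx, ← hu.system x hx α]
    simp only [partialDeriv_partialDeriv (hc.contDiffAt (hΩ.mem_nhds hx))]
  have hbd : ∀ x ∈ frontier Ω, u x α - ε * inner ℝ e x = 0 := fun x hx => by
    rw [hu.boundary x hx, hψ x hx, sub_self]
  intro x hx
  have hle := nonpos_of_maximum_principle hn hΩ hΩb (hc.sub hl.contDiffOn)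
    (hcc.sub hl.continuous.continuousOn) hP hsys (fun x hx => (hbd x hx).le) x hx
  have hneg2 : ∀ x, fderiv ℝ (fderiv ℝ fun y => -(u y α - ε * inner ℝ e y)) x =
      -fderiv ℝ (fderiv ℝ fun y => u y α - ε * inner ℝ e y) x := by
    intro x
    have : fderiv ℝ (fun y => -(u y α - ε * inner ℝ e y)) =
        fun y => -fderiv ℝ (fun y => u y α - ε * inner ℝ e y) y := by
      ext1 y; exact fderiv_fun_neg
    rw [this, fderiv_fun_neg]
  have hge := nonpos_of_maximum_principle (w := fun y => -(u y α - ε * inner ℝ e y)) hn hΩ hΩb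
    (hc.sub hl.contDiffOn).neg (hcc.sub hl.continuous.continuousOn).neg hP
    (fun x hx => by
      simp only [hneg2, neg_apply, mul_neg, Finset.sum_neg_distrib, hsys x hx, neg_zero])
    (fun x hx => by simp [hbd x hx]) x hx
  linarith

end MinimalGraph

end

theorem theorem6p1 (n : ℕ) (hn : 3 ≤ n) (Ω : Set (MinimalGraph.Euc n))
    (hΩ : MinimalGraph.IsBoundedSmoothDomain Ω) (hmc : MinimalGraph.IsMeanConvex Ω)
    (hq : ∃ q ∈ frontier Ω, MinimalGraph.IsNonconvexMinimalPoint Ω q)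
    (ε : ℝ) (hε : 0 < ε) (hε1 : ε ≤ 1) :
    ∃ ψ : MinimalGraph.Euc n → MinimalGraph.Euc 2,
      ContDiff ℝ 2 ψ ∧
      (∀ x ∈ closure Ω, ‖fderiv ℝ (fun y => ψ y 0) x‖ ≤ ε) ∧
      ¬ ∃ u : MinimalGraph.Euc n → MinimalGraph.Euc 2,
        MinimalGraph.IsClassicalSolution Ω ψ u := by
  open MinimalGraph in
  obtain ⟨q, hq, f, hf, hH, hX⟩ := hq
  obtain ⟨e, he, hte, hpos⟩ := exists_tangent_hessian_pos hf.smooth hf.fderiv_ne_zero hH hX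
  have hcurv : levelCurvature (ε ^ 2 / (1 + ε ^ 2)) e f q < 0 := by
    rw [levelCurvature_eq hf.fderiv_ne_zero hH hte]
    have hG : 0 < ‖gradient f q‖ := by
      rw [gradient, LinearIsometryEquiv.norm_map]
      exact norm_pos_iff.2 hf.fderiv_ne_zero
    have : 0 < ε ^ 2 / (1 + ε ^ 2) * ‖gradient f q‖ ^ 2 * fderiv ℝ (fderiv ℝ f) q e e := by
      positivity
    linarith
  obtain ⟨r, hr, C, hC⟩ := exists_boundary_bound hn hΩ.isOpen hΩ.isBounded
    (by nlinarith : ε ^ 2 ≤ 1) he hq hf hcurv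
  -- The bump is `1` at `q` and vanishes at distance at least `r`, so `(C + 1) χ` meets the
  -- hypothesis of the boundary estimate but violates its conclusion.
  let χ : ContDiffBump q := ⟨r / 2, r, by positivity, by linarith⟩
  refine ⟨fun x => WithLp.toLp 2 ![ε * inner ℝ e x, (C + 1) * χ x], ?_, ?_, ?_⟩
  · rw [contDiff_euclidean]
    intro α
    fin_cases α
    · exact contDiff_const.mul (contDiff_const.inner ℝ contDiff_id)
    · exact contDiff_const.mul χ.contDiff
  · intro x _
    change ‖fderiv ℝ (fun y => ε * inner ℝ e y) x‖ ≤ ε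
    have h := congrArg norm (gradient_linear ε e x)
    rw [gradient, LinearIsometryEquiv.norm_map, norm_smul, he, mul_one, Real.norm_of_nonneg hε.le]
      at h
    exact h.le
  · rintro ⟨u, hu⟩
    have hlin := hu.component_eq_linear (by omega) hΩ.isOpen hΩ.isBounded 0 (ε := ε) (e := e)
      fun x _ => rfl
    have hc := contDiffOn_component hu.contDiffOn 1
    -- With the first component linear, the system reduces to a scalar equation for the second.
    have hmet : ∀ x ∈ Ω, graphMetric u x = metricOf ε e (gradient (fun y => u y 1) x) := by
      intro x hx
      have h0 : gradient (fun y => u y 0) x = ε • e := by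
        rw [← gradient_linear ε e x, gradient, gradient]
        congr 1
        refine Filter.EventuallyEq.fderiv_eq ?_
        filter_upwards [hΩ.isOpen.mem_nhds hx] with y hy using hlin y hy
      rw [graphMetric_eq, Fin.sum_univ_two, h0, metricOf, ← add_assoc]
      congr 2
      ext i j
      simp [Matrix.vecMulVec_apply]
      ring
    have hle := hC (fun y => u y 1) hc
      ((EuclideanSpace.proj (𝕜 := ℝ) 1).continuous.comp_continuousOn hu.continuousOn) ?_ ?_
    · have : u q 1 = (C + 1) * χ q := by rw [hu.boundary q hq]; rfl
      rw [χ.one_of_mem_closedBall (Metric.mem_closedBall_self (by positivity))] at this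
      simp only [this] at hle
      linarith
    · intro x hx
      rw [← hmet x hx, ← hu.system x hx 1]
      simp only [partialDeriv_partialDeriv (hc.contDiffAt (hΩ.isOpen.mem_nhds hx))]
    · intro x hx hxr
      have : u x 1 = (C + 1) * χ x := by rw [hu.boundary x hx]; rfl
      rw [χ.zero_of_le_dist (by rwa [dist_eq_norm])] at this
      simp [this]
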